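/- \textbf{Theorem (higher-order upper-moment inequality).} Let $f$ be a probability density on $\mathbb R$ (extended by $0$ outside its support) with support of edges $x_i<x_f$. For a vector $\vec\alpha=(\alpha_0,\dots,\alpha_{n})$ with all $\alpha_j\neq 2$, define recursively, with values in $[0,\infty]$, $U_{\emptyset}(x)=|x|$ and $$U_{(\alpha_0,\dots,\alpha_n)}(x)=\int_{x}^{x_{f}}\Big(|\alpha_0-2|\,U_{(\alpha_1,\dots,\alpha_n)}(t)\Big)^{\frac1{\alpha_0-2}}f(t)\,dt ,$$ the upper-moment $M_{p,\vec\alpha}[f]=\int_{\mathbb R}U_{\vec\alpha}(x)^p f(x)\,dx$, and the upper-deviation $$m_{p,\vec\alpha}[f]=M_{p,\vec\alpha}[f]^{\frac1p\prod_{j}(\alpha_j-2)}\quad(p\neq0),\qquad m_{0,\vec\alpha}[f]=\exp\Big(\int_{\mathbb R} f\log U_{\vec\alpha}\,dx\Big)^{\prod_j(\alpha_j-2)} ;$$ for the empty vector, $m_{q,\emptyset}[f]=\sigma_q[f]$ is the usual deviation $\left(\int|x|^qf\right)^{1/q}$ (with $\sigma_0[f]=\exp\int f\log|x|$). Let $\vec\alpha=(\alpha_0,\alpha_1,\dots,\alpha_n)$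 with $n\ge 0$ and all $\alpha_j\ne2$, and let $\vec\alpha'=(\alpha_1,\dots,\alpha_n)$. Let $p,q\in\mathbb R$, $p\neq1$, $p^*=\frac p{p-1}$, satisfy either $$p^*>0\ \text{ and }\ (\alpha_0-2)q<\frac{p^*}{p^*+1},$$ or $$1+q(2-\alpha_0)<0\ \text{ and }\ \operatorname{sign}\big[(2-\alpha_0)q(1+p^*)+p^*\big]=\operatorname{sign}(p^*-1).$$ Put $$\xi=\frac{p^*}{\alpha_0-2}+\frac{2-p^*}{\alpha_0-2}\operatorname{sign}\big(1+(2-\alpha_0)q\big),$$ and let $N$ be the number of entries of $\vec\alpha'$ that are smaller than $2$. Then there is a constant $k>0$, depending only on $p,q,\vec\alpha$, such that for every probability density $f$: (i) if $\xi>0$ and $N$ is even, or $\xi<0$ and $N$ is odd, then $m_{p^*,\vec\alpha}[f]\ge k\,m_{q,\vec\alpha'}[f]$; (ii) if $\xi>0$ and $N$ is odd, or $\xi<0$ and $N$ is even, then $m_{p^*,\vec\alpha}[f]\le k\,m_{q,\vec\alpha'}[f]$. In particular $m_{p^*,\vec\alpha}[f]/m_{q,\vec\alpha'}[f]\ge k$,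 respectively $\le k$, whenever both deviations are positive and finite. The inequalities are understood in $[0,\infty]$ (with $0\cdot\infty=0$, and $\infty-\infty=-\infty$ for the logarithmic integral). They hold, with the same $k$, also if at each level of the recursion the integral $\int_x^{x_f}$ is replaced by $\int_{x_i}^{x}$ or not, the same choice being used for the common levels of $\vec\alpha$ and $\vec\alpha'$. -/

import Mathlib

open MeasureTheory
open scoped ENNReal NNReal

noncomputable section

namespace UpperMoment

/-- `f` is a probability density on the real line (it vanishes off its support). -/
structure IsProbDensity (f : ℝ → ℝ) : Prop where
  measurable : Measurable f
  nonneg : ∀ x, 0 ≤ f x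
  lintegral_eq_one : ∫⁻ x, ENNReal.ofReal (f x) = 1

/-- The half-line between `x` and an edge of the support: the upper edge for `true`, the lower edge
for `false`. Since a density vanishes off its support, integrating over `(x, ∞)` is the same as
integrating over `(x, x_f)`, and similarly at the lower edge. -/
def side (upper : Bool) (x : ℝ) : Set ℝ :=
  bif upper then Set.Ioi x else Set.Iio x

/-- The nested inner integrals, with values in `[0, ∞]`. For the empty vector this is `|x|`, and
`nested f e (a :: l) x = ∫_{x}^{edge} (|a - 2| * nested f e l t) ^ (1 / (a - 2)) f(t) dt`.
The constants `|a - 2|` are kept inside the integrals; pulling them out of the `p`-th power of the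
full expression produces the factor
`∏_j |α_j - 2| ^ (p / ((α_0 - 2) ⋯ (α_j - 2)))`.
The integral attached to the entry `a` of `a :: l` runs up to the edge `e l.length`; taking
`e = fun _ => true` makes every inner integral run up to the upper edge of the support. -/
def nested (f : ℝ → ℝ) (e : ℕ → Bool) : List ℝ → ℝ → ℝ≥0∞
  | [], x => ENNReal.ofReal |x|
  | a :: l, x =>
      ∫⁻ t in side (e l.length) x,
        (ENNReal.ofReal |a - 2| * nested f e l t) ^ (1 / (a - 2)) * ENNReal.ofReal (f t)

/-- The upper-moment `M_{p,α}[f] = ∫ (nested integral)^p f`; for the empty vector it is the absolute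
moment `∫ |x|^p f(x) dx`. -/
def moment (f : ℝ → ℝ) (e : ℕ → Bool) (p : ℝ) (α : List ℝ) : ℝ≥0∞ :=
  ∫⁻ x, nested f e α x ^ p * ENNReal.ofReal (f x)

/-- `∫ log(nested integral) f`, as the integral of the positive part minus that of the negative
part. -/
def logMean (f : ℝ → ℝ) (e : ℕ → Bool) (α : List ℝ) : EReal :=
  ((∫⁻ x, (ENNReal.log (nested f e α x)).toENNReal * ENNReal.ofReal (f x) : ℝ≥0∞) : EReal)
    - ((∫⁻ x, (-ENNReal.log (nested f e α x)).toENNReal * ENNReal.ofReal (f x) : ℝ≥0∞) : EReal)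

/-- The product `(α_0 - 2)(α_1 - 2) ⋯`; it is `1` for the empty vector. -/
def shiftProd (α : List ℝ) : ℝ := (α.map fun a => a - 2).prod

/-- The upper-deviation `m_{p,α}[f] = M_{p,α}[f] ^ (∏ (α_j - 2) / p)`, and for `p = 0` its limit
value `exp (∫ log(nested integral) f) ^ ∏ (α_j - 2)`. For the empty vector this is the typical
deviation `σ_p[f]`, including `σ_0[f] = exp (∫ log |x| f(x) dx)`. -/
def deviation (f : ℝ → ℝ) (e : ℕ → Bool) (p : ℝ) (α : List ℝ) : ℝ≥0∞ :=
  if p = 0 then (logMean f e α).exp ^ shiftProd α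
  else moment f e p α ^ (shiftProd α / p)

/-- The conjugate exponent `p* = p / (p - 1)`, for `p ≠ 1`. -/
def conj (p : ℝ) : ℝ := p / (p - 1)

/-- The classical range of parameters. -/
def Classical (p a q : ℝ) : Prop :=
  0 < conj p ∧ (a - 2) * q < conj p / (conj p + 1)

/-- The mirrored range of parameters. -/
def Mirrored (p a q : ℝ) : Prop :=
  1 + q * (2 - a) < 0 ∧
    Real.sign ((2 - a) * q * (1 + conj p) + conj p) = Real.sign (conj p - 1)

/-- `ξ(p, α, q) = p* / (α - 2) + (2 - p*) / (α - 2) * sign (1 + (2 - α) q)`. -/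
def xi (p a q : ℝ) : ℝ :=
  conj p / (a - 2) + (2 - conj p) / (a - 2) * Real.sign (1 + (2 - a) * q)

/-- The number of entries smaller than `2`. -/
def numLt (α : List ℝ) : ℕ := α.countP fun a => decide (a < 2)

end UpperMoment

end

open MeasureTheory
open scoped ENNReal NNReal

/-! ### Power means of a `[0, ∞]`-valued function under a probability measure. -/

namespace UpperMoment

/-! Let μ have density `f`, let V be the nested integral of α', and let W = (|α₀ - 2| V)^(1/(α₀ -
2)). The nested integral of α is then the tail T(x) of ∫ W dμ. A deviation is a power mean raised to
`shiftProd`, and M_{(α₀-2)ρ}(W)^(α₀-2) = |α₀ - 2| M_ρ(V). So everything reduces to comparing power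
means of W and of T; the recursion inside V plays no role.

In the classical range, with s = p*, a reverse Hardy inequality M_r(W) ≤ C M_s(T) holds for 0 < r <
s/(s+1) (`exists_powerMean_le_tail`). Cutting the line at the quantiles of mass 2^-(n+1) turns it
into a geometric series, convergent exactly in this range of r. Taking r also above (α₀-2)q,
monotonicity of power means in the exponent passes from r/(α₀-2) to q.

In the mirrored range p* < 1 < (α₀-2)q, and T ≤ ∫ W dμ gives the opposite bound M_{p*}(T) ≤ C
M_{(α₀-2)q}(W).

Raising to the power α₀ - 2 and then to `shiftProd α'` reverses the inequality once for each
negative exponent; this is what the sign of ξ and the parity of N record. Constants are not sharp,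
so monotonicity in the exponent is only needed up to a factor, which also makes the conventions at 0
and ∞ easier to handle. -/

/-- The logarithmic mean `∫ log Y dμ`, as an integral of a positive part minus one of a negative
part. -/
noncomputable def logIntegral (μ : Measure ℝ) (Y : ℝ → ℝ≥0∞) : EReal :=
  ((∫⁻ x, (ENNReal.log (Y x)).toENNReal ∂μ : ℝ≥0∞) : EReal)
    - ((∫⁻ x, (-ENNReal.log (Y x)).toENNReal ∂μ : ℝ≥0∞) : EReal)

/-- The power mean of exponent `s`; for `s = 0` it is the geometric mean. -/
noncomputable def powerMean (μ : Measure ℝ) (s : ℝ) (Y : ℝ → ℝ≥0∞) : ℝ≥0∞ :=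
  if s = 0 then (logIntegral μ Y).exp else (∫⁻ x, Y x ^ s ∂μ) ^ (1 / s)

lemma powerMean_of_ne_zero (μ : Measure ℝ) {s : ℝ} (hs : s ≠ 0) (Y : ℝ → ℝ≥0∞) :
    powerMean μ s Y = (∫⁻ x, Y x ^ s ∂μ) ^ (1 / s) := if_neg hs

lemma powerMean_zero (μ : Measure ℝ) (Y : ℝ → ℝ≥0∞) :
    powerMean μ 0 Y = (logIntegral μ Y).exp := if_pos rfl

lemma powerMean_one (μ : Measure ℝ) (Y : ℝ → ℝ≥0∞) : powerMean μ 1 Y = ∫⁻ x, Y x ∂μ := by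
  simp [powerMean]

lemma powerMean_rpow (μ : Measure ℝ) {s : ℝ} (hs : s ≠ 0) (Y : ℝ → ℝ≥0∞) :
    powerMean μ s Y ^ s = ∫⁻ x, Y x ^ s ∂μ := by
  rw [powerMean_of_ne_zero μ hs, ← ENNReal.rpow_mul, one_div_mul_cancel hs, ENNReal.rpow_one]

lemma powerMean_inv (μ : Measure ℝ) {s : ℝ} (hs : s ≠ 0) (Y : ℝ → ℝ≥0∞) :
    powerMean μ s (fun x => (Y x)⁻¹) = (powerMean μ (-s) Y)⁻¹ := by
  rw [powerMean_of_ne_zero μ hs, powerMean_of_ne_zero μ (neg_ne_zero.2 hs), ← ENNReal.rpow_neg]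
  simp only [ENNReal.inv_rpow, ENNReal.rpow_neg]
  rw [← ENNReal.rpow_neg]
  congr 1
  field_simp

lemma rpow_le_rpow_of_nonpos {x y : ℝ≥0∞} {z : ℝ} (hz : z ≤ 0) (h : x ≤ y) : y ^ z ≤ x ^ z := by
  rw [← neg_neg z, ENNReal.rpow_neg y, ENNReal.rpow_neg x]
  exact ENNReal.inv_le_inv.2 (ENNReal.rpow_le_rpow h (neg_nonneg.2 hz))

/-- Hölder's inequality against the constant `1`. -/
lemma lintegral_rpow_le_measure_rpow_mul (μ : Measure ℝ) {W : ℝ → ℝ≥0∞} (hW : Measurable W)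
    {r : ℝ} (h0 : 0 ≤ r) (h1 : r ≤ 1) :
    ∫⁻ x, W x ^ r ∂μ ≤ (∫⁻ x, W x ∂μ) ^ r * μ Set.univ ^ (1 - r) := by
  simpa using ENNReal.lintegral_mul_norm_pow_le (μ := μ) (f := W) (g := fun _ => 1)
    hW.aemeasurable aemeasurable_const h0 (sub_nonneg.2 h1) (by ring)

lemma powerMean_le_of_pos_of_le (μ : Measure ℝ) [IsProbabilityMeasure μ] {Y : ℝ → ℝ≥0∞}
    (hY : Measurable Y) {s ρ : ℝ} (hs : 0 < s) (h : s ≤ ρ) :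
    powerMean μ s Y ≤ powerMean μ ρ Y := by
  have hρ : 0 < ρ := hs.trans_le h
  have key := lintegral_rpow_le_measure_rpow_mul μ (hY.pow_const ρ) (r := s / ρ) (by positivity)
    ((div_le_one hρ).2 h)
  simp only [← ENNReal.rpow_mul, measure_univ, ENNReal.one_rpow, mul_one,
    mul_div_cancel₀ s hρ.ne'] at key
  rw [powerMean_of_ne_zero μ hs.ne', powerMean_of_ne_zero μ hρ.ne']
  calc _ ≤ ((∫⁻ x, Y x ^ ρ ∂μ) ^ (s / ρ)) ^ (1 / s) := by gcongr
    _ = _ := by rw [← ENNReal.rpow_mul]; congr 1; field_simp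

/-- Markov's inequality for Y^ρ at twice its mean. The means 0 and ∞ are treated apart because the
argument cancels the mean. -/
lemma half_le_measure_le_powerMean (μ : Measure ℝ) [IsProbabilityMeasure μ] {Y : ℝ → ℝ≥0∞}
    (hY : Measurable Y) {ρ : ℝ} (hρ : 0 < ρ) :
    2⁻¹ ≤ μ {x | Y x ≤ 2 ^ (1 / ρ) * powerMean μ ρ Y} := by
  set I := ∫⁻ x, Y x ^ ρ ∂μ with hI
  have hset : {x | Y x ≤ 2 ^ (1 / ρ) * powerMean μ ρ Y} = {x | Y x ^ ρ ≤ 2 * I} := by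
    ext x
    rw [Set.mem_ofPred_eq, Set.mem_ofPred_eq, ← ENNReal.rpow_le_rpow_iff hρ,
      ENNReal.mul_rpow_of_nonneg _ _ hρ.le, powerMean_rpow μ hρ.ne', ← ENNReal.rpow_mul,
      one_div_mul_cancel hρ.ne', ENNReal.rpow_one]
  rw [hset]
  by_cases h0 : I = 0
  · have : ∀ᵐ x ∂μ, Y x ^ ρ = 0 := by
      simpa [Filter.EventuallyEq] using (lintegral_eq_zero_iff (hY.pow_const ρ)).1 h0
    have h1 : μ {x | Y x ^ ρ ≤ 2 * I} = 1 := by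
      rw [prob_compl_eq_zero_iff (measurableSet_le (hY.pow_const ρ) measurable_const) |>.symm]
      filter_upwards [this] with x hx
      simp [hx]
    rw [h1]; simp
  by_cases ht : I = ∞
  · simp [ht]
  have hM := mul_meas_ge_le_lintegral (μ := μ) (hY.pow_const ρ) (2 * I)
  rw [← hI] at hM
  have hM' : μ {x | 2 * I ≤ Y x ^ ρ} ≤ 2⁻¹ := by
    have : I * (2 * μ {x | 2 * I ≤ Y x ^ ρ}) ≤ I * 1 := by
      rw [mul_one, ← mul_assoc, mul_comm I 2]; exact hM
    have := (ENNReal.mul_le_mul_iff_right h0 ht).1 this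
    rw [mul_comm] at this
    rw [← one_div]
    exact (ENNReal.le_div_iff_mul_le (by simp) (by simp)).2 this
  have hc : 1 ≤ μ {x | Y x ^ ρ ≤ 2 * I} + μ {x | 2 * I ≤ Y x ^ ρ} := by
    rw [← measure_univ (μ := μ)]
    refine (measure_mono fun x _ => ?_).trans (measure_union_le _ _)
    exact le_total (Y x ^ ρ) (2 * I)
  have : (2⁻¹ : ℝ≥0∞) + 2⁻¹ ≤ μ {x | Y x ^ ρ ≤ 2 * I} + 2⁻¹ := by
    rw [ENNReal.inv_two_add_inv_two]
    exact hc.trans (by gcongr)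
  exact (ENNReal.add_le_add_iff_right (by simp)).1 this

/-- On a set of mass at least 1/2, Y is at most a multiple of its ρ-mean; for s < 0 that set alone
bounds ∫ Y^s from below, hence the s-mean from above. -/
lemma powerMean_le_of_neg (μ : Measure ℝ) [IsProbabilityMeasure μ] {Y : ℝ → ℝ≥0∞}
    (hY : Measurable Y) {s ρ : ℝ} (hs : s < 0) (hρ : 0 < ρ) :
    powerMean μ s Y ≤ 2⁻¹ ^ (1 / s) * 2 ^ (1 / ρ) * powerMean μ ρ Y := by
  set D := 2 ^ (1 / ρ) * powerMean μ ρ Y with hD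
  have h1 : D ^ s * 2⁻¹ ≤ ∫⁻ x, Y x ^ s ∂μ :=
    calc D ^ s * 2⁻¹ ≤ D ^ s * μ {x | Y x ≤ D} := by
          gcongr; exact half_le_measure_le_powerMean μ hY hρ
      _ = ∫⁻ _ in {x | Y x ≤ D}, D ^ s ∂μ := by simp
      _ ≤ ∫⁻ x in {x | Y x ≤ D}, Y x ^ s ∂μ := by
          refine setLIntegral_mono' (measurableSet_le hY measurable_const) fun x hx => ?_
          exact rpow_le_rpow_of_nonpos hs.le hx
      _ ≤ _ := setLIntegral_le_lintegral _ _
  rw [powerMean_of_ne_zero μ hs.ne]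
  calc (∫⁻ x, Y x ^ s ∂μ) ^ (1 / s) ≤ (D ^ s * 2⁻¹) ^ (1 / s) :=
        rpow_le_rpow_of_nonpos (one_div_nonpos.2 hs.le) h1
    _ = 2⁻¹ ^ (1 / s) * D := by
        -- A negative power of a product splits here because the factor 2⁻¹ is neither 0 nor ∞.
        rw [mul_comm (D ^ s), ENNReal.mul_rpow_eq_ite, if_neg (by simp), ← ENNReal.rpow_mul,
          mul_one_div_cancel hs.ne, ENNReal.rpow_one]
    _ = _ := by rw [hD, mul_assoc]

lemma toENNReal_log_le (Y : ℝ≥0∞) {σ : ℝ} (hσ : 0 < σ) :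
    (ENNReal.log Y).toENNReal ≤ ENNReal.ofReal (1 / σ) * Y ^ σ := by
  rcases eq_or_ne Y 0 with rfl | h0
  · simp
  rcases eq_or_ne Y ∞ with rfl | ht
  · simp [ENNReal.top_rpow_of_pos hσ, ENNReal.mul_top, hσ]
  have hy : 0 < Y.toReal := ENNReal.toReal_pos h0 ht
  rw [ENNReal.log_pos_real h0 ht, EReal.real_coe_toENNReal, ← ENNReal.ofReal_toReal ht,
    ENNReal.ofReal_rpow_of_pos hy, ← ENNReal.ofReal_mul (by positivity),
    ENNReal.toReal_ofReal hy.le]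
  refine ENNReal.ofReal_le_ofReal ?_
  have := Real.log_le_sub_one_of_pos (Real.rpow_pos_of_pos hy σ)
  rw [Real.log_rpow hy] at this
  rw [div_mul_eq_mul_div, one_mul, le_div_iff₀ hσ]
  linarith

/-- This is log y ≤ log m + (y/m)^σ / σ, from log u ≤ u - 1 at u = (y/m)^σ, with negative parts
moved across so that no subtraction in `[0, ∞]` occurs and it can be integrated termwise. -/
lemma toENNReal_log_add_le (Y : ℝ≥0∞) {σ m : ℝ} (hσ : 0 < σ) (hm : 0 < m) :
    (ENNReal.log Y).toENNReal + ENNReal.ofReal (-Real.log m) ≤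
      (-ENNReal.log Y).toENNReal + ENNReal.ofReal (Real.log m)
        + ENNReal.ofReal (1 / (σ * m ^ σ)) * Y ^ σ := by
  have hmσ := Real.rpow_pos_of_pos hm σ
  rcases eq_or_ne Y 0 with rfl | h0
  · simp
  rcases eq_or_ne Y ∞ with rfl | ht
  · rw [ENNReal.top_rpow_of_pos hσ, ENNReal.mul_top (by positivity)]
    simp
  have hy : 0 < Y.toReal := ENNReal.toReal_pos h0 ht
  have hneg : -((Real.log Y.toReal : ℝ) : EReal) = ((-Real.log Y.toReal : ℝ) : EReal) := by simp
  rw [ENNReal.log_pos_real h0 ht, hneg, EReal.real_coe_toENNReal, EReal.real_coe_toENNReal]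
  nth_rewrite 3 [← ENNReal.ofReal_toReal ht]
  rw [ENNReal.ofReal_rpow_of_pos hy, ← ENNReal.ofReal_mul (by positivity)]
  set y := Y.toReal
  have key : Real.log y ≤ Real.log m + 1 / (σ * m ^ σ) * y ^ σ := by
    have := Real.log_le_sub_one_of_pos (Real.rpow_pos_of_pos (div_pos hy hm) σ)
    rw [Real.log_rpow (div_pos hy hm), Real.log_div hy.ne' hm.ne', Real.div_rpow hy.le hm.le] at this
    have h2 : 1 / (σ * m ^ σ) * y ^ σ = (y ^ σ / m ^ σ) / σ := by field_simp
    have h3 : Real.log y - Real.log m ≤ (y ^ σ / m ^ σ) / σ := by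
      rw [le_div_iff₀ hσ]; linarith
    linarith
  have hpos : 0 ≤ 1 / (σ * m ^ σ) * y ^ σ := by positivity
  -- Making the truncation explicit lets the `ENNReal.ofReal` terms be added as nonnegative reals.
  have hA : ∀ a : ℝ, ENNReal.ofReal a = ENNReal.ofReal (max a 0) := fun a => by
    rcases le_total a 0 with h | h
    · rw [max_eq_right h, ENNReal.ofReal_of_nonpos h, ENNReal.ofReal_zero]
    · rw [max_eq_left h]
  rw [hA (Real.log y), hA (-Real.log m), hA (-Real.log y), hA (Real.log m),
    ← ENNReal.ofReal_add (by positivity) (by positivity),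
    ← ENNReal.ofReal_add (by positivity) (by positivity),
    ← ENNReal.ofReal_add (by positivity) hpos]
  refine ENNReal.ofReal_le_ofReal ?_
  have e1 := max_zero_sub_eq_self (Real.log y)
  have e2 := max_zero_sub_eq_self (Real.log m)
  linarith

lemma lintegral_toENNReal_log_add_le (μ : Measure ℝ) [IsProbabilityMeasure μ] {Y : ℝ → ℝ≥0∞}
    (hY : Measurable Y) {σ m : ℝ} (hσ : 0 < σ) (hm : 0 < m)
    (h : powerMean μ σ Y = ENNReal.ofReal m) :
    (∫⁻ x, (ENNReal.log (Y x)).toENNReal ∂μ) + ENNReal.ofReal (-Real.log m) ≤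
      (∫⁻ x, (-ENNReal.log (Y x)).toENNReal ∂μ) + ENNReal.ofReal (Real.log m)
        + ENNReal.ofReal (1 / σ) := by
  have hint : ∫⁻ x, Y x ^ σ ∂μ = ENNReal.ofReal (m ^ σ) := by
    rw [← powerMean_rpow μ hσ.ne', h, ENNReal.ofReal_rpow_of_pos hm]
  have hmσ := Real.rpow_pos_of_pos hm σ
  have hP : Measurable fun x => (ENNReal.log (Y x)).toENNReal := hY.ennreal_log.ereal_toENNReal
  have hN : Measurable fun x => (-ENNReal.log (Y x)).toENNReal :=
    hY.ennreal_log.neg.ereal_toENNReal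
  have := lintegral_mono (μ := μ) fun x => toENNReal_log_add_le (Y x) hσ hm
  rw [lintegral_add_left hP, lintegral_add_right _ ((hY.pow_const σ).const_mul _),
    lintegral_add_left hN, lintegral_const_mul _ (hY.pow_const σ), hint,
    ← ENNReal.ofReal_mul (by positivity)] at this
  simp only [lintegral_const, measure_univ, mul_one] at this
  refine this.trans_eq ?_
  congr 2
  field_simp

lemma coe_sub_coe_le {P N : ℝ≥0∞} {l d : ℝ} (hd : 0 ≤ d)
    (h : P + ENNReal.ofReal (-l) ≤ N + ENNReal.ofReal l + ENNReal.ofReal d) :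
    (P : EReal) - (N : EReal) ≤ ((l + d : ℝ) : EReal) := by
  -- An infinite negative part makes the difference `⊥`, even when P is infinite too.
  rcases eq_or_ne N ∞ with rfl | hN
  · simp
  have hP : P ≠ ∞ := by
    rintro rfl
    simp [hN] at h
  lift N to ℝ≥0 using hN
  lift P to ℝ≥0 using hP
  have h' := (ENNReal.toReal_le_toReal (by simp) (by simp)).2 h
  rw [ENNReal.toReal_add (by simp) (by simp), ENNReal.toReal_add (by simp) (by simp),
    ENNReal.toReal_add (by simp) (by simp), ENNReal.coe_toReal, ENNReal.coe_toReal,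
    ENNReal.toReal_ofReal', ENNReal.toReal_ofReal', ENNReal.toReal_ofReal hd] at h'
  have e := max_zero_sub_eq_self l
  have e' : (P : ℝ) - N ≤ l + d := by linarith
  have e'' : (((P : ℝ) - (N : ℝ) : ℝ) : EReal) ≤ ((l + d : ℝ) : EReal) := EReal.coe_le_coe_iff.2 e'
  rw [EReal.coe_sub] at e''
  exact e''

lemma ae_eq_zero_of_powerMean_eq_zero (μ : Measure ℝ) {Y : ℝ → ℝ≥0∞} (hY : Measurable Y) {σ : ℝ}
    (hσ : 0 < σ) (h : powerMean μ σ Y = 0) : ∀ᵐ x ∂μ, Y x = 0 := by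
  have h' : ∫⁻ x, Y x ^ σ ∂μ = 0 := by
    rw [← powerMean_rpow μ hσ.ne', h, ENNReal.zero_rpow_of_pos hσ]
  filter_upwards [(lintegral_eq_zero_iff (hY.pow_const σ)).1 h'] with x hx
  exact (ENNReal.rpow_eq_zero_iff_of_pos hσ).1 hx

/-- Jensen's inequality for the logarithm, up to a constant. -/
lemma powerMean_zero_le (μ : Measure ℝ) [IsProbabilityMeasure μ] {Y : ℝ → ℝ≥0∞}
    (hY : Measurable Y) {σ : ℝ} (hσ : 0 < σ) :
    powerMean μ 0 Y ≤ ENNReal.ofReal (Real.exp (1 / σ)) * powerMean μ σ Y := by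
  rcases eq_or_ne (powerMean μ σ Y) ∞ with ht | ht
  · rw [ht, ENNReal.mul_top (by simp [Real.exp_pos])]
    exact le_top
  rcases eq_or_ne (powerMean μ σ Y) 0 with h0 | h0
  · have hN : ∫⁻ x, (-ENNReal.log (Y x)).toENNReal ∂μ = ∞ := by
      rw [lintegral_congr_ae (g := fun _ => ∞)]
      · simp
      · filter_upwards [ae_eq_zero_of_powerMean_eq_zero μ hY hσ h0] with x hx
        simp [hx]
    simp [powerMean_zero, logIntegral, hN]
  have hm := ENNReal.toReal_pos h0 ht
  have h := (ENNReal.ofReal_toReal ht).symm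
  have key := coe_sub_coe_le (by positivity) (lintegral_toENNReal_log_add_le μ hY hσ hm h)
  rw [powerMean_zero, logIntegral, h, ← ENNReal.ofReal_mul (Real.exp_pos _).le]
  refine (EReal.exp_monotone key).trans_eq ?_
  rw [EReal.exp_coe, Real.exp_add, Real.exp_log hm, mul_comm]

/-- Apply `powerMean_zero_le` to Y⁻¹. -/
lemma le_powerMean_zero (μ : Measure ℝ) [IsProbabilityMeasure μ] {Y : ℝ → ℝ≥0∞}
    (hY : Measurable Y) {σ : ℝ} (hσ : 0 < σ) :
    powerMean μ (-σ) Y ≤ ENNReal.ofReal (Real.exp (1 / σ)) * powerMean μ 0 Y := by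
  set c := ENNReal.ofReal (Real.exp (1 / σ))
  have hc0 : c ≠ 0 := by simp [c, Real.exp_pos]
  have hct : c ≠ ∞ := by simp [c]
  have hZ := powerMean_inv μ hσ.ne' Y
  rw [← inv_inv (powerMean μ (-σ) Y), ← hZ]
  set P := ∫⁻ x, (ENNReal.log (Y x)).toENNReal ∂μ with hP
  set N := ∫⁻ x, (-ENNReal.log (Y x)).toENNReal ∂μ with hN
  -- Here ∞ - ∞ = -∞ for both Y and Y⁻¹, so inversion fails for the geometric mean. Instead N = ∞
  -- forces ∫ Y^(-σ) = ∞, and the left side is 0.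
  by_cases hPN : P = ∞ ∧ N = ∞
  · have hYσ : Measurable fun x => (Y x)⁻¹ ^ σ := hY.inv.pow_const σ
    have hle : N ≤ ENNReal.ofReal (1 / σ) * ∫⁻ x, ((Y x)⁻¹) ^ σ ∂μ := by
      rw [← lintegral_const_mul _ hYσ]
      refine lintegral_mono fun x => ?_
      simpa [ENNReal.log_inv] using toENNReal_log_le (Y x)⁻¹ hσ
    rw [hPN.2, top_le_iff, ENNReal.mul_eq_top] at hle
    have hI : ∫⁻ x, ((Y x)⁻¹) ^ σ ∂μ = ∞ := by
      rcases hle with h | h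
      · exact h.2
      · simp at h
    rw [powerMean_of_ne_zero μ hσ.ne', hI, ENNReal.top_rpow_of_pos (by positivity)]
    simp
  · have hinv : powerMean μ 0 (fun x => (Y x)⁻¹) = (powerMean μ 0 Y)⁻¹ := by
      rw [powerMean_zero, powerMean_zero, ← EReal.exp_neg]
      congr 1
      simp only [logIntegral, ENNReal.log_inv, neg_neg, ← hP, ← hN]
      rw [EReal.neg_sub, add_comm, sub_eq_add_neg]
      · exact Or.inl (EReal.coe_ennreal_ne_bot _)
      · by_cases h : P = ∞
        · right
          simpa using fun h' => hPN ⟨h, h'⟩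
        · left
          simpa using h
    have := powerMean_zero_le μ (Y := fun x => (Y x)⁻¹) hY.inv hσ
    rw [hinv] at this
    rw [← ENNReal.inv_le_inv, inv_inv, ENNReal.mul_inv (Or.inl hc0) (Or.inl hct)]
    rw [← ENNReal.div_eq_inv_mul, ENNReal.div_le_iff hc0 hct, mul_comm]
    exact this

lemma exists_powerMean_le {s ρ : ℝ} (hρ : 0 < ρ) (h : s ≤ ρ) :
    ∃ C : ℝ≥0, 0 < C ∧ ∀ (μ : Measure ℝ) [IsProbabilityMeasure μ] (Y : ℝ → ℝ≥0∞), Measurable Y →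
      powerMean μ s Y ≤ C * powerMean μ ρ Y := by
  rcases lt_trichotomy s 0 with hs | rfl | hs
  · have h0 : (2⁻¹ : ℝ≥0∞) ^ (1 / s) * 2 ^ (1 / ρ) ≠ 0 := by simp
    have ht : (2⁻¹ : ℝ≥0∞) ^ (1 / s) * 2 ^ (1 / ρ) ≠ ∞ := by
      refine ENNReal.mul_ne_top ?_ ?_ <;> simp
    lift (2⁻¹ : ℝ≥0∞) ^ (1 / s) * 2 ^ (1 / ρ) to ℝ≥0 using ht with C hC
    refine ⟨C, by simpa [pos_iff_ne_zero] using h0, fun μ _ Y hY => ?_⟩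
    rw [hC]
    exact powerMean_le_of_neg μ hY hs hρ
  · exact ⟨(Real.exp (1 / ρ)).toNNReal, by simp [Real.exp_pos], fun μ _ Y hY =>
      powerMean_zero_le μ hY hρ⟩
  · exact ⟨1, one_pos, fun μ _ Y hY => by simpa using powerMean_le_of_pos_of_le μ hY hs h⟩

lemma exists_le_powerMean {s ρ : ℝ} (hρ : ρ < 0) (h : ρ ≤ s) :
    ∃ C : ℝ≥0, 0 < C ∧ ∀ (μ : Measure ℝ) [IsProbabilityMeasure μ] (Y : ℝ → ℝ≥0∞), Measurable Y →
      powerMean μ ρ Y ≤ C * powerMean μ s Y := by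
  rcases eq_or_ne s 0 with rfl | hs
  · exact ⟨(Real.exp (1 / -ρ)).toNNReal, by simp [Real.exp_pos], fun μ _ Y hY => by
      have := le_powerMean_zero μ hY (neg_pos.2 hρ)
      rw [neg_neg] at this
      exact this⟩
  · obtain ⟨C, hC, H⟩ := exists_powerMean_le (neg_pos.2 hρ) (neg_le_neg h)
    refine ⟨C, hC, fun μ _ Y hY => ?_⟩
    have := H μ (fun x => (Y x)⁻¹) hY.inv
    rw [powerMean_inv μ (neg_ne_zero.2 hs), powerMean_inv μ (neg_ne_zero.2 hρ.ne), neg_neg,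
      neg_neg, ← div_eq_mul_inv] at this
    have hc0 : (C : ℝ≥0∞) ≠ 0 := by simpa using hC.ne'
    rw [← ENNReal.inv_le_inv, ENNReal.mul_inv (Or.inl hc0) (Or.inl (by simp)),
      ← ENNReal.div_eq_inv_mul, ENNReal.div_le_iff hc0 (by simp), mul_comm, ← div_eq_mul_inv]
    exact this

end UpperMoment

/-! ### Quantiles and the reverse Hardy inequality. -/

namespace UpperMoment

lemma continuous_cdf (μ : Measure ℝ) [IsProbabilityMeasure μ] [NullSingletonClass μ] :
    Continuous (ProbabilityTheory.cdf μ) := by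
  set F := ProbabilityTheory.cdf μ with hF
  refine continuous_iff_continuousAt.2 fun x => ?_
  rw [F.mono.continuousAt_iff_leftLim_eq_rightLim, F.rightLim_eq]
  refine le_antisymm (F.mono.leftLim_le le_rfl) ?_
  have h := F.measure_singleton x
  rw [hF, ProbabilityTheory.measure_cdf, measure_singleton] at h
  have := ENNReal.ofReal_eq_zero.1 h.symm
  linarith

lemma exists_measure_Iic_eq (μ : Measure ℝ) [IsProbabilityMeasure μ] [NullSingletonClass μ] {t : ℝ}
    (h0 : 0 < t) (h1 : t < 1) : ∃ c, μ (Set.Iic c) = ENNReal.ofReal t := by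
  obtain ⟨c, hc⟩ := mem_range_of_exists_le_of_exists_ge (continuous_cdf μ)
    (((ProbabilityTheory.tendsto_cdf_atBot μ).eventually_le_const h0).exists)
    (((ProbabilityTheory.tendsto_cdf_atTop μ).eventually_const_le h1).exists)
  exact ⟨c, by rw [← hc, ProbabilityTheory.ofReal_cdf]⟩

/-- The tail decreases in its starting point, so every x ≤ c contributes at least the value at c. -/
lemma measure_Iic_mul_tail_rpow_le (μ : Measure ℝ) (W : ℝ → ℝ≥0∞) {s : ℝ} (hs : 0 ≤ s) (c : ℝ) :
    (∫⁻ t in Set.Ioi c, W t ∂μ) ^ s * μ (Set.Iic c) ≤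
      ∫⁻ x, (∫⁻ t in Set.Ioi x, W t ∂μ) ^ s ∂μ :=
  calc (∫⁻ t in Set.Ioi c, W t ∂μ) ^ s * μ (Set.Iic c)
      = ∫⁻ _ in Set.Iic c, (∫⁻ t in Set.Ioi c, W t ∂μ) ^ s ∂μ := by simp
    _ ≤ ∫⁻ x in Set.Iic c, (∫⁻ t in Set.Ioi x, W t ∂μ) ^ s ∂μ := by
        refine setLIntegral_mono' measurableSet_Iic fun x hx => ?_
        exact ENNReal.rpow_le_rpow (lintegral_mono_set (Set.Ioi_subset_Ioi hx)) hs
    _ ≤ _ := setLIntegral_le_lintegral _ _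

lemma pow_rpow_comm (a : ℝ≥0∞) (n : ℕ) (x : ℝ) : (a ^ n) ^ x = (a ^ x) ^ n := by
  rw [← ENNReal.rpow_natCast, ← ENNReal.rpow_natCast, ← ENNReal.rpow_mul, ← ENNReal.rpow_mul,
    mul_comm]

/-- On the n-th quantile piece, Hölder gives (tail at c n)^r · 2^(-n(1-r)), while the mass 2^-(n+1)
to the left of c n bounds the tail there by (2^(n+1) I)^(1/s). -/
lemma lintegral_rpow_le_tsum (μ : Measure ℝ) [IsProbabilityMeasure μ] [NullSingletonClass μ]
    {W : ℝ → ℝ≥0∞} (hW : Measurable W) {r s : ℝ} (hr : 0 < r) (hr1 : r < 1) (hs : 0 < s) :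
    ∫⁻ x, W x ^ r ∂μ ≤ ∑' n : ℕ, 2 ^ (r / s) * (2 ^ (r / s) * 2⁻¹ ^ (1 - r)) ^ n *
      (∫⁻ x, (∫⁻ t in Set.Ioi x, W t ∂μ) ^ s ∂μ) ^ (r / s) := by
  set I := ∫⁻ x, (∫⁻ t in Set.Ioi x, W t ∂μ) ^ s ∂μ with hI
  have hc : ∀ n : ℕ, ∃ c, μ (Set.Iic c) = 2⁻¹ ^ (n + 1) := fun n => by
    obtain ⟨c, hc⟩ := exists_measure_Iic_eq μ (t := 2⁻¹ ^ (n + 1)) (by positivity)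
      (pow_lt_one₀ (by norm_num) (by norm_num) (by simp))
    refine ⟨c, hc.trans ?_⟩
    rw [ENNReal.ofReal_pow (by norm_num), ENNReal.ofReal_inv_of_pos (by norm_num)]
    norm_num
  choose c hc using hc
  -- A point outside every piece lies, by induction, below every c n, so the pieces cover almost
  -- everything. Overlaps would do no harm, as only subadditivity is used.
  let A : ℕ → Set ℝ := fun n => Nat.casesOn n (Set.Ioi (c 0)) fun k => Set.Ioc (c (k + 1)) (c k)
  have hA : ∀ n, A n ⊆ Set.Ioi (c n) := fun n => by
    cases n with
    | zero => exact subset_rfl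
    | succ k => exact Set.Ioc_subset_Ioi_self
  have hAμ : ∀ n, μ (A n) ≤ 2⁻¹ ^ n := fun n => by
    cases n with
    | zero => simpa using prob_le_one
    | succ k => exact (measure_mono Set.Ioc_subset_Iic_self).trans (hc k).le
  have hcover : (⋃ n, A n : Set ℝ) =ᵐ[μ] Set.univ := by
    rw [ae_eq_univ]
    have hsub : ∀ n, (⋃ n, A n)ᶜ ⊆ Set.Iic (c n) := fun n x hx => by
      simp only [Set.compl_iUnion, Set.mem_iInter, Set.mem_compl_iff] at hx
      induction n with
      | zero => exact not_lt.1 (show ¬ c 0 < x from hx 0)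
      | succ k ih => exact not_lt.1 fun h => hx (k + 1) ⟨h, ih⟩
    refine le_antisymm (ge_of_tendsto'
      (ENNReal.tendsto_pow_atTop_nhds_zero_of_lt_one (r := 2⁻¹) (by simp)) fun n => ?_) zero_le
    refine (measure_mono (hsub n)).trans ((hc n).trans_le ?_)
    exact pow_le_pow_right_of_le_one' (by simp) (Nat.le_succ n)
  have htail : ∀ n, (∫⁻ t in Set.Ioi (c n), W t ∂μ) ^ r ≤ 2 ^ (r / s) * (2 ^ (r / s)) ^ n *
      I ^ (r / s) := fun n => by
    have h := measure_Iic_mul_tail_rpow_le μ W hs.le (c n)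
    rw [hc n, ← ENNReal.inv_pow, ← div_eq_mul_inv, ENNReal.div_le_iff (by simp) (by simp)] at h
    calc (∫⁻ t in Set.Ioi (c n), W t ∂μ) ^ r
        = ((∫⁻ t in Set.Ioi (c n), W t ∂μ) ^ s) ^ (r / s) := by
          rw [← ENNReal.rpow_mul, mul_div_cancel₀ r hs.ne']
      _ ≤ (I * 2 ^ (n + 1)) ^ (r / s) := by gcongr
      _ = _ := by
          rw [ENNReal.mul_rpow_of_nonneg _ _ (by positivity), pow_rpow_comm, pow_succ]
          ring
  calc ∫⁻ x, W x ^ r ∂μ = ∫⁻ x in ⋃ n, A n, W x ^ r ∂μ := by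
        rw [setLIntegral_congr hcover, setLIntegral_univ]
    _ ≤ ∑' n, ∫⁻ x in A n, W x ^ r ∂μ := lintegral_iUnion_le _ _
    _ ≤ _ := ENNReal.tsum_le_tsum fun n => by
        have h := lintegral_rpow_le_measure_rpow_mul (μ.restrict (A n)) hW hr.le hr1.le
        rw [Measure.restrict_apply_univ] at h
        calc _ ≤ _ := h
          _ ≤ (∫⁻ t in Set.Ioi (c n), W t ∂μ) ^ r * (2⁻¹ ^ n) ^ (1 - r) := by
            have := sub_nonneg.2 hr1.le
            gcongr
            · exact hA n
            · exact hAμ n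
          _ ≤ (2 ^ (r / s) * (2 ^ (r / s)) ^ n * I ^ (r / s)) * (2⁻¹ ^ n) ^ (1 - r) := by
            gcongr; exact htail n
          _ = _ := by rw [pow_rpow_comm, mul_pow]; ring

/-- A reverse Hardy inequality: the tails of `W` control its power mean of exponent `r`. -/
lemma exists_powerMean_le_tail_Ioi {r s : ℝ} (hr : 0 < r) (hs : 0 < s) (hrs : r < s / (s + 1)) :
    ∃ C : ℝ≥0, 0 < C ∧ ∀ (μ : Measure ℝ) [IsProbabilityMeasure μ] [NullSingletonClass μ]
      (W : ℝ → ℝ≥0∞), Measurable W →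
      powerMean μ r W ≤ C * powerMean μ s fun x => ∫⁻ t in Set.Ioi x, W t ∂μ := by
  rw [lt_div_iff₀ (by positivity)] at hrs
  have hr1 : r < 1 := by nlinarith
  set θ : ℝ≥0∞ := 2 ^ (r / s) * 2⁻¹ ^ (1 - r) with hθ
  -- The ratio is 2^(r/s - (1 - r)), and r/s < 1 - r is a rewriting of r < s/(s+1).
  have hθ1 : θ < 1 := by
    rw [hθ, ENNReal.inv_rpow, ← ENNReal.rpow_neg, ← ENNReal.rpow_add _ _ (by simp) (by simp)]
    refine ENNReal.rpow_lt_one_of_one_lt_of_neg (by simp) ?_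
    have : r / s < 1 - r := by rw [div_lt_iff₀ hs]; linarith
    linarith
  have hK0 : (2 ^ (r / s) * (1 - θ)⁻¹) ^ (1 / r) ≠ 0 := by
    have : (2 : ℝ≥0∞) ^ (r / s) * (1 - θ)⁻¹ ≠ 0 := mul_ne_zero (by simp) (by simp)
    simp [ENNReal.rpow_eq_zero_iff, this, hr.le]
  have hKt : (2 ^ (r / s) * (1 - θ)⁻¹) ^ (1 / r) ≠ ∞ := by
    refine ENNReal.rpow_ne_top_of_nonneg (by positivity) (ENNReal.mul_ne_top (by simp) ?_)
    simpa [tsub_eq_zero_iff_le] using hθ1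
  refine ⟨((2 ^ (r / s) * (1 - θ)⁻¹) ^ (1 / r)).toNNReal,
    ENNReal.toNNReal_pos hK0 hKt, fun μ _ _ W hW => ?_⟩
  rw [ENNReal.coe_toNNReal hKt, powerMean_of_ne_zero μ hr.ne', powerMean_of_ne_zero μ hs.ne']
  have h := lintegral_rpow_le_tsum μ hW hr hr1 hs
  rw [ENNReal.tsum_mul_right, ENNReal.tsum_mul_left, ← hθ, ENNReal.tsum_geometric] at h
  refine (ENNReal.rpow_le_rpow h (by positivity : 0 ≤ 1 / r)).trans_eq ?_
  rw [ENNReal.mul_rpow_of_nonneg _ _ (by positivity), ← ENNReal.rpow_mul]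
  congr 2
  field_simp

lemma measurableSet_side (b : Bool) (x : ℝ) : MeasurableSet (side b x) := by
  cases b
  · exact measurableSet_Iio
  · exact measurableSet_Ioi

lemma measurable_tail (μ : Measure ℝ) (b : Bool) (W : ℝ → ℝ≥0∞) :
    Measurable fun x => ∫⁻ t in side b x, W t ∂μ := by
  cases b
  · exact Monotone.measurable fun x y h => lintegral_mono_set (Set.Iio_subset_Iio h)
  · exact Antitone.measurable fun x y h => lintegral_mono_set (Set.Ioi_subset_Ioi h)

lemma exists_powerMean_le_tail {r s : ℝ} (hr : 0 < r) (hs : 0 < s) (hrs : r < s / (s + 1)) :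
    ∃ C : ℝ≥0, 0 < C ∧ ∀ (μ : Measure ℝ) [IsProbabilityMeasure μ] [NullSingletonClass μ] (b : Bool)
      (W : ℝ → ℝ≥0∞), Measurable W →
      powerMean μ r W ≤ C * powerMean μ s fun x => ∫⁻ t in side b x, W t ∂μ := by
  obtain ⟨C, hC, H⟩ := exists_powerMean_le_tail_Ioi hr hs hrs
  refine ⟨C, hC, fun μ _ _ b W hW => ?_⟩
  cases b with
  | true => exact H μ W hW
  | false =>
    -- The reflection x ↦ -x exchanges the two kinds of tails.
    let e := MeasurableEquiv.neg ℝ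
    have hp : IsProbabilityMeasure (μ.map e) := Measure.isProbabilityMeasure_map e.measurable.aemeasurable
    have ha : NullSingletonClass (μ.map e) := ⟨fun x => by
      have : e ⁻¹' {x} = {-x} := by ext y; simp [e]
      rw [e.map_apply, this, measure_singleton]⟩
    have h := H (μ.map e) (fun x => W (-x)) (hW.comp measurable_neg)
    have hneg : ∀ x, W (-(e x)) = W x := fun x => congrArg W (neg_neg x)
    have htail : ∀ x, ∫⁻ t in Set.Ioi (e x), W (-t) ∂(μ.map e) = ∫⁻ t in side false x, W t ∂μ := by
      intro x
      have : e ⁻¹' Set.Ioi (e x) = side false x := by ext; simp [e, side]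
      rw [e.restrict_map, lintegral_map_equiv, this]
      simp only [hneg]
    rw [powerMean_of_ne_zero _ hr.ne', powerMean_of_ne_zero _ hs.ne', lintegral_map_equiv,
      lintegral_map_equiv] at h
    rw [powerMean_of_ne_zero _ hr.ne', powerMean_of_ne_zero _ hs.ne']
    simpa only [htail, hneg] using h

end UpperMoment

/-! ### Deviations as power means under the density measure. -/

namespace UpperMoment

/-- The probability measure with density `f`. -/
noncomputable def densityMeasure (f : ℝ → ℝ) : Measure ℝ :=
  volume.withDensity fun x => ENNReal.ofReal (f x)

instance (f : ℝ → ℝ) : NullSingletonClass (densityMeasure f) :=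
  inferInstanceAs (NullSingletonClass (volume.withDensity _))

lemma IsProbDensity.isProbabilityMeasure {f : ℝ → ℝ} (hf : IsProbDensity f) :
    IsProbabilityMeasure (densityMeasure f) :=
  ⟨by rw [densityMeasure, withDensity_apply _ MeasurableSet.univ, setLIntegral_univ,
    hf.lintegral_eq_one]⟩

lemma IsProbDensity.lintegral {f : ℝ → ℝ} (hf : IsProbDensity f) {g : ℝ → ℝ≥0∞}
    (hg : Measurable g) :
    ∫⁻ x, g x ∂(densityMeasure f) = ∫⁻ x, g x * ENNReal.ofReal (f x) := by
  rw [densityMeasure, lintegral_withDensity_eq_lintegral_mul _ hf.measurable.ennreal_ofReal hg]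
  simp only [Pi.mul_apply, mul_comm]

lemma IsProbDensity.setLIntegral {f : ℝ → ℝ} (hf : IsProbDensity f) {g : ℝ → ℝ≥0∞}
    (hg : Measurable g) {s : Set ℝ} (hs : MeasurableSet s) :
    ∫⁻ x in s, g x ∂(densityMeasure f) = ∫⁻ x in s, g x * ENNReal.ofReal (f x) := by
  rw [densityMeasure,
    setLIntegral_withDensity_eq_setLIntegral_mul _ hf.measurable.ennreal_ofReal hg hs]
  simp only [Pi.mul_apply, mul_comm]

lemma measurable_nested (f : ℝ → ℝ) (e : ℕ → Bool) : ∀ α : List ℝ, Measurable (nested f e α)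
  | [] => measurable_id.abs.ennreal_ofReal
  | a :: l => measurable_tail volume (e l.length) fun t =>
      (ENNReal.ofReal |a - 2| * nested f e l t) ^ (1 / (a - 2)) * ENNReal.ofReal (f t)

/-- The integrand of the outermost integral, stripped of the density. -/
noncomputable def weight (a : ℝ) (V : ℝ → ℝ≥0∞) (x : ℝ) : ℝ≥0∞ :=
  (ENNReal.ofReal |a - 2| * V x) ^ (1 / (a - 2))

lemma measurable_weight (a : ℝ) {V : ℝ → ℝ≥0∞} (hV : Measurable V) : Measurable (weight a V) :=
  (hV.const_mul _).pow_const _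

lemma IsProbDensity.nested_cons {f : ℝ → ℝ} (hf : IsProbDensity f) (e : ℕ → Bool) (a : ℝ)
    (l : List ℝ) :
    nested f e (a :: l) =
      fun x => ∫⁻ t in side (e l.length) x, weight a (nested f e l) t ∂(densityMeasure f) := by
  funext x
  rw [hf.setLIntegral (measurable_weight a (measurable_nested f e l)) (measurableSet_side _ x)]
  rfl

lemma IsProbDensity.deviation_eq {f : ℝ → ℝ} (hf : IsProbDensity f) (e : ℕ → Bool) (q : ℝ)
    (α : List ℝ) :
    deviation f e q α = powerMean (densityMeasure f) q (nested f e α) ^ shiftProd α := by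
  have hm := measurable_nested f e α
  rcases eq_or_ne q 0 with rfl | hq
  · have hneg : Measurable fun x => (-ENNReal.log (nested f e α x)).toENNReal :=
      hm.ennreal_log.neg.ereal_toENNReal
    rw [powerMean_zero, deviation, if_pos rfl, logIntegral,
      hf.lintegral hm.ennreal_log.ereal_toENNReal, hf.lintegral hneg]
    rfl
  · rw [powerMean_of_ne_zero _ hq, deviation, if_neg hq, hf.lintegral (hm.pow_const q),
      ← ENNReal.rpow_mul, one_div_mul_eq_div]
    rfl

lemma const_mul_rpow {c : ℝ≥0∞} (h0 : c ≠ 0) (ht : c ≠ ∞) (x : ℝ≥0∞) (z : ℝ) :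
    (c * x) ^ z = c ^ z * x ^ z := by
  rw [ENNReal.mul_rpow_eq_ite, if_neg (by simp [h0, ht])]

/-- The exponent (a - 2)ρ cancels the root in `weight`, leaving the ρ-mean of V and a constant; this
carries bounds on W over to V exactly. -/
lemma powerMean_weight_rpow (μ : Measure ℝ) {a ρ : ℝ} (ha : a ≠ 2) (hρ : ρ ≠ 0) {V : ℝ → ℝ≥0∞}
    (hV : Measurable V) :
    powerMean μ ((a - 2) * ρ) (weight a V) ^ (a - 2) =
      ENNReal.ofReal |a - 2| * powerMean μ ρ V := by
  have ha' : a - 2 ≠ 0 := sub_ne_zero.2 ha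
  have hc0 : ENNReal.ofReal |a - 2| ≠ 0 := by simpa using ha'
  have hct : ENNReal.ofReal |a - 2| ≠ ∞ := ENNReal.ofReal_ne_top
  rw [powerMean_of_ne_zero μ (mul_ne_zero ha' hρ), powerMean_of_ne_zero μ hρ]
  have h : ∀ x, weight a V x ^ ((a - 2) * ρ) = ENNReal.ofReal |a - 2| ^ ρ * V x ^ ρ := fun x => by
    rw [weight, ← ENNReal.rpow_mul, ← const_mul_rpow hc0 hct]
    congr 1
    field_simp
  simp only [h]
  have hcρ0 : ENNReal.ofReal |a - 2| ^ ρ ≠ 0 := by simp [ENNReal.rpow_eq_zero_iff, hc0, hct]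
  have hcρt : ENNReal.ofReal |a - 2| ^ ρ ≠ ∞ := by simp [ENNReal.rpow_eq_top_iff, hc0, hct]
  have he : 1 / ((a - 2) * ρ) * (a - 2) = 1 / ρ := by field_simp
  rw [lintegral_const_mul _ (hV.pow_const ρ), ← ENNReal.rpow_mul, he, const_mul_rpow hcρ0 hcρt,
    ← ENNReal.rpow_mul, mul_one_div_cancel hρ, ENNReal.rpow_one]

/-! ### Comparisons uniform over all densities and choices of edges. -/

/-- `X` is bounded by `Y` up to a positive finite constant. -/
def Dominated {ι : Type*} (X Y : ι → ℝ≥0∞) : Prop :=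
  ∃ C : ℝ≥0, 0 < C ∧ ∀ i, X i ≤ C * Y i

namespace Dominated

variable {ι : Type*} {X Y Z : ι → ℝ≥0∞}

lemma trans (h : Dominated X Y) (h' : Dominated Y Z) : Dominated X Z := by
  obtain ⟨C, hC, H⟩ := h
  obtain ⟨D, hD, H'⟩ := h'
  refine ⟨C * D, mul_pos hC hD, fun i => (H i).trans ?_⟩
  rw [ENNReal.coe_mul, mul_assoc]
  gcongr
  exact H' i

lemma of_le (h : ∀ i, X i ≤ Y i) : Dominated X Y := ⟨1, one_pos, by simpa using h⟩

lemma exists_mul_le (h : Dominated X Y) : ∃ k : ℝ≥0, 0 < k ∧ ∀ i, k * X i ≤ Y i := by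
  obtain ⟨C, hC, H⟩ := h
  refine ⟨C⁻¹, inv_pos.2 hC, fun i => ?_⟩
  rw [ENNReal.coe_inv hC.ne', ← ENNReal.div_eq_inv_mul]
  exact ENNReal.div_le_of_le_mul' (H i)

lemma of_mul_le {k : ℝ≥0} (hk : 0 < k) (h : ∀ i, k * X i ≤ Y i) : Dominated X Y := by
  refine ⟨k⁻¹, inv_pos.2 hk, fun i => ?_⟩
  rw [ENNReal.coe_inv hk.ne', ← ENNReal.div_eq_inv_mul,
    ENNReal.le_div_iff_mul_le (by simp [hk.ne']) (by simp), mul_comm]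
  exact h i

lemma rpow_of_nonneg (h : Dominated X Y) {t : ℝ} (ht : 0 ≤ t) :
    Dominated (fun i => X i ^ t) fun i => Y i ^ t := by
  obtain ⟨C, hC, H⟩ := h
  refine ⟨C ^ t, NNReal.rpow_pos hC, fun i => ?_⟩
  rw [ENNReal.coe_rpow_of_ne_zero hC.ne', ← ENNReal.mul_rpow_of_nonneg _ _ ht]
  exact ENNReal.rpow_le_rpow (H i) ht

lemma rpow_of_nonpos (h : Dominated X Y) {t : ℝ} (ht : t ≤ 0) :
    Dominated (fun i => Y i ^ t) fun i => X i ^ t := by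
  obtain ⟨C, hC, H⟩ := h
  refine of_mul_le (k := C ^ t) (NNReal.rpow_pos hC) fun i => ?_
  rw [ENNReal.coe_rpow_of_ne_zero hC.ne',
    ← const_mul_rpow (by simpa using hC.ne') ENNReal.coe_ne_top]
  exact rpow_le_rpow_of_nonpos ht (H i)

end Dominated

/-- A density together with a choice of edges. -/
abbrev Datum : Type := {f : ℝ → ℝ // IsProbDensity f} × (ℕ → Bool)

/-- The measure of a datum. -/
noncomputable abbrev Datum.measure (i : Datum) : Measure ℝ := densityMeasure i.1.1

instance (i : Datum) : IsProbabilityMeasure i.measure := i.1.2.isProbabilityMeasure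

/-- The power mean of the nested integral. -/
noncomputable def nestedMean (q : ℝ) (α : List ℝ) (i : Datum) : ℝ≥0∞ :=
  powerMean i.measure q (nested i.1.1 i.2 α)

/-- The power mean of the outermost integrand of the nested integral. -/
noncomputable def weightMean (r a : ℝ) (α : List ℝ) (i : Datum) : ℝ≥0∞ :=
  powerMean i.measure r (weight a (nested i.1.1 i.2 α))

lemma dominated_nestedMean_of_pos {q ρ : ℝ} (hρ : 0 < ρ) (h : q ≤ ρ) (α : List ℝ) :
    Dominated (nestedMean q α) (nestedMean ρ α) := by
  obtain ⟨C, hC, H⟩ := exists_powerMean_le hρ h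
  exact ⟨C, hC, fun i => H i.measure _ (measurable_nested _ _ _)⟩

lemma dominated_nestedMean_of_neg {q ρ : ℝ} (hρ : ρ < 0) (h : ρ ≤ q) (α : List ℝ) :
    Dominated (nestedMean ρ α) (nestedMean q α) := by
  obtain ⟨C, hC, H⟩ := exists_le_powerMean hρ h
  exact ⟨C, hC, fun i => H i.measure _ (measurable_nested _ _ _)⟩

lemma weightMean_rpow {a ρ : ℝ} (ha : a ≠ 2) (hρ : ρ ≠ 0) (α : List ℝ) (i : Datum) :
    weightMean ((a - 2) * ρ) a α i ^ (a - 2) = ENNReal.ofReal |a - 2| * nestedMean ρ α i :=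
  powerMean_weight_rpow _ ha hρ (measurable_nested _ _ _)

lemma dominated_weightMean_rpow {a ρ : ℝ} (ha : a ≠ 2) (hρ : ρ ≠ 0) (α : List ℝ) :
    Dominated (fun i => weightMean ((a - 2) * ρ) a α i ^ (a - 2)) (nestedMean ρ α) :=
  ⟨|a - 2|.toNNReal, by simpa [sub_eq_zero] using ha, fun i => (weightMean_rpow ha hρ α i).le⟩

lemma weightMean_rpow_dominates {a ρ : ℝ} (ha : a ≠ 2) (hρ : ρ ≠ 0) (α : List ℝ) :
    Dominated (nestedMean ρ α) (fun i => weightMean ((a - 2) * ρ) a α i ^ (a - 2)) :=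
  .of_mul_le (k := |a - 2|.toNNReal) (by simpa [sub_eq_zero] using ha)
    fun i => (weightMean_rpow ha hρ α i).ge

lemma dominated_weightMean_nestedMean {r s : ℝ} (hr : 0 < r) (hs : 0 < s) (hrs : r < s / (s + 1))
    (a : ℝ) (α : List ℝ) : Dominated (weightMean r a α) (nestedMean s (a :: α)) := by
  obtain ⟨C, hC, H⟩ := exists_powerMean_le_tail hr hs hrs
  refine ⟨C, hC, fun i => ?_⟩
  rw [nestedMean, i.1.2.nested_cons]
  exact H i.measure _ _ (measurable_weight a (measurable_nested _ _ _))

/-- Exponent 1 lies between s and r, and each tail is at most the full integral, which is the 1-mean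
of the weight. -/
lemma dominated_nestedMean_weightMean {r s : ℝ} (hs : s ≤ 1) (hr : 1 ≤ r)
    (a : ℝ) (α : List ℝ) : Dominated (nestedMean s (a :: α)) (weightMean r a α) := by
  refine (dominated_nestedMean_of_pos one_pos hs _).trans (.of_le fun i => ?_)
  have hm := measurable_weight a (measurable_nested i.1.1 i.2 α)
  refine le_trans ?_ (powerMean_le_of_pos_of_le i.measure hm one_pos hr)
  rw [nestedMean, powerMean_one, powerMean_one, i.1.2.nested_cons]
  calc _ ≤ ∫⁻ _, (∫⁻ t, weight a (nested i.1.1 i.2 α) t ∂i.measure) ∂i.measure :=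
        lintegral_mono fun x => setLIntegral_le_lintegral _ _
    _ = _ := by simp

/-! ### The two parameter ranges, the sign of ξ and the sign of the exponents. -/

lemma xi_of_classical {p a q : ℝ} (h : Classical p a q) : xi p a q = 2 / (a - 2) := by
  obtain ⟨h0, h1⟩ := h
  have : conj p / (conj p + 1) < 1 := (div_lt_one (by linarith)).2 (by linarith)
  rw [xi, Real.sign_of_pos (by linarith)]
  ring

/-- If p* > 1, then (2 - a)q < -1 makes the first sign argument less than -1, contradicting equality
of signs. The value p* = 1 is never attained. -/
lemma conj_lt_one_of_mirrored {p a q : ℝ} (hp : p ≠ 1) (h : Mirrored p a q) : conj p < 1 := by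
  obtain ⟨h0, h1⟩ := h
  have hne : conj p ≠ 1 := fun h => by
    rw [conj, div_eq_one_iff_eq (sub_ne_zero.2 hp)] at h
    linarith
  by_contra hlt
  have hgt : 1 < conj p := lt_of_le_of_ne (not_lt.1 hlt) hne.symm
  rw [Real.sign_of_pos (sub_pos.2 hgt), Real.sign_of_neg (by nlinarith)] at h1
  norm_num at h1

lemma xi_of_mirrored {p a q : ℝ} (h : Mirrored p a q) : xi p a q = 2 * (conj p - 1) / (a - 2) := by
  rw [xi, Real.sign_of_neg (by linarith [h.1])]
  ring

/-- The comparison of the nested integral with its outermost integrand, before the deviations are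
raised to the power `shiftProd`. -/
lemma dominated_of_xi {p q a : ℝ} (hp : p ≠ 1) (ha : a ≠ 2) (α : List ℝ)
    (h : Classical p a q ∨ Mirrored p a q) :
    (0 < xi p a q → Dominated (nestedMean q α)
      fun i => nestedMean (conj p) (a :: α) i ^ (a - 2)) ∧
    (xi p a q < 0 → Dominated (fun i => nestedMean (conj p) (a :: α) i ^ (a - 2))
      (nestedMean q α)) := by
  have ha' : a - 2 ≠ 0 := sub_ne_zero.2 ha
  rcases h with h | h
  · rw [xi_of_classical h]
    obtain ⟨hs, hq⟩ := h
    have hpos : 0 < conj p / (conj p + 1) := by positivity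
    -- r must be positive and below s/(s+1) for the Hardy bound, and at least (a - 2)q so that r/(a
    -- - 2) lies above q when a > 2 and below q when a < 2. Its sign is that of a - 2, as the
    -- comparison of means requires.
    obtain ⟨r, hr, hrs⟩ := exists_between (max_lt hq hpos)
    have hr0 : 0 < r := (le_max_right _ _).trans_lt hr
    have hqr : (a - 2) * q ≤ r := (le_max_left _ _).trans hr.le
    have hD := dominated_weightMean_nestedMean hr0 hs hrs a α
    have hρ : r / (a - 2) ≠ 0 := div_ne_zero hr0.ne' ha'
    have hrρ : (a - 2) * (r / (a - 2)) = r := mul_div_cancel₀ r ha'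
    rw [← hrρ] at hD
    constructor <;> intro hξ
    · have ha2 : 0 < a - 2 := by simpa using hξ
      exact (dominated_nestedMean_of_pos (div_pos hr0 ha2)
        ((le_div_iff₀' ha2).2 hqr) α).trans
        ((weightMean_rpow_dominates ha hρ α).trans (hD.rpow_of_nonneg ha2.le))
    · have ha2 : a - 2 < 0 := by
        by_contra hcon
        exact absurd hξ (not_lt.2 (div_nonneg zero_le_two (not_lt.1 hcon)))
      exact (hD.rpow_of_nonpos ha2.le).trans ((dominated_weightMean_rpow ha hρ α).trans
        (dominated_nestedMean_of_neg (div_neg_of_pos_of_neg hr0 ha2)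
          ((div_le_iff_of_neg' ha2).2 hqr) α))
  · rw [xi_of_mirrored h]
    have hs := conj_lt_one_of_mirrored hp h
    have hr : 1 < (a - 2) * q := by linarith [h.1]
    have hq : q ≠ 0 := by
      rintro rfl
      norm_num at hr
    have hD := dominated_nestedMean_weightMean hs.le hr.le a α
    constructor <;> intro hξ
    -- Since p* - 1 < 0, ξ and a - 2 have opposite signs here.
    · have ha2 : a - 2 < 0 := by
        by_contra hcon
        exact absurd hξ (not_lt.2 (div_nonpos_of_nonpos_of_nonneg (by linarith) (not_lt.1 hcon)))
      exact (weightMean_rpow_dominates ha hq α).trans (hD.rpow_of_nonpos ha2.le)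
    · have ha2 : 0 < a - 2 := by
        by_contra hcon
        exact absurd hξ (not_lt.2 (div_nonneg_of_nonpos (by linarith) (not_lt.1 hcon)))
      exact (hD.rpow_of_nonneg ha2.le).trans (dominated_weightMean_rpow ha hq α)

lemma shiftProd_sign (α : List ℝ) (h : ∀ a ∈ α, a ≠ 2) :
    (Even (numLt α) → 0 < shiftProd α) ∧ (Odd (numLt α) → shiftProd α < 0) := by
  induction α with
  | nil => simp [numLt, shiftProd]
  | cons a l ih =>
    obtain ⟨h1, h2⟩ := ih fun b hb => h b (List.mem_cons_of_mem a hb)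
    have hS : shiftProd (a :: l) = (a - 2) * shiftProd l := by simp [shiftProd]
    rw [hS]
    rcases lt_or_gt_of_ne (h a List.mem_cons_self) with ha | ha
    · have hN : numLt (a :: l) = numLt l + 1 := by simp [numLt, ha]
      rw [hN, Nat.even_add_one, Nat.odd_add_one, Nat.not_even_iff_odd, Nat.not_odd_iff_even]
      exact ⟨fun hl => mul_pos_of_neg_of_neg (by linarith) (h2 hl),
        fun hl => mul_neg_of_neg_of_pos (by linarith) (h1 hl)⟩
    · have hN : numLt (a :: l) = numLt l := by simp [numLt, ha.le]
      rw [hN]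
      exact ⟨fun hl => mul_pos (by linarith) (h1 hl),
        fun hl => mul_neg_of_pos_of_neg (by linarith) (h2 hl)⟩

/-- The deviation as a function of the datum. -/
noncomputable def deviationAt (q : ℝ) (α : List ℝ) (i : Datum) : ℝ≥0∞ :=
  deviation i.1.1 i.2 q α

lemma deviationAt_eq (q : ℝ) (α : List ℝ) :
    deviationAt q α = fun i => nestedMean q α i ^ shiftProd α :=
  funext fun i => i.1.2.deviation_eq i.2 q α

lemma deviationAt_cons_eq (q a : ℝ) (α : List ℝ) :
    deviationAt q (a :: α) = fun i => (nestedMean q (a :: α) i ^ (a - 2)) ^ shiftProd α := by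
  rw [deviationAt_eq]
  funext i
  rw [← ENNReal.rpow_mul]
  simp [shiftProd]

lemma dominated_deviationAt {p q a : ℝ} {α : List ℝ} (hp : p ≠ 1) (ha : a ≠ 2)
    (hα : ∀ b ∈ α, b ≠ 2) (h : Classical p a q ∨ Mirrored p a q) :
    (0 < xi p a q ∧ Even (numLt α) ∨ xi p a q < 0 ∧ Odd (numLt α) →
      Dominated (deviationAt q α) (deviationAt (conj p) (a :: α))) ∧
    (0 < xi p a q ∧ Odd (numLt α) ∨ xi p a q < 0 ∧ Even (numLt α) →
      Dominated (deviationAt (conj p) (a :: α)) (deviationAt q α)) := by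
  obtain ⟨h1, h2⟩ := dominated_of_xi hp ha α h
  obtain ⟨s1, s2⟩ := shiftProd_sign α hα
  rw [deviationAt_eq q α, deviationAt_cons_eq]
  constructor
  · rintro (⟨hξ, hN⟩ | ⟨hξ, hN⟩)
    · exact (h1 hξ).rpow_of_nonneg (s1 hN).le
    · exact (h2 hξ).rpow_of_nonpos (s2 hN).le
  · rintro (⟨hξ, hN⟩ | ⟨hξ, hN⟩)
    · exact (h1 hξ).rpow_of_nonpos (s2 hN).le
    · exact (h2 hξ).rpow_of_nonneg (s1 hN).le

end UpperMoment

theorem mainTheorem2 (p q α₀ : ℝ) (α' : List ℝ) (hp : p ≠ 1) (hα₀ : α₀ ≠ 2)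
    (hα' : ∀ a ∈ α', a ≠ 2)
    (hpq : UpperMoment.Classical p α₀ q ∨ UpperMoment.Mirrored p α₀ q) :
    ∃ k : ℝ≥0, 0 < k ∧
      ∀ (f : ℝ → ℝ) (e : ℕ → Bool), UpperMoment.IsProbDensity f →
        ((0 < UpperMoment.xi p α₀ q ∧ Even (UpperMoment.numLt α') ∨
            UpperMoment.xi p α₀ q < 0 ∧ Odd (UpperMoment.numLt α')) →
          (k : ℝ≥0∞) * UpperMoment.deviation f e q α' ≤
            UpperMoment.deviation f e (UpperMoment.conj p) (α₀ :: α')) ∧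
        ((0 < UpperMoment.xi p α₀ q ∧ Odd (UpperMoment.numLt α') ∨
            UpperMoment.xi p α₀ q < 0 ∧ Even (UpperMoment.numLt α')) →
          UpperMoment.deviation f e (UpperMoment.conj p) (α₀ :: α') ≤
            (k : ℝ≥0∞) * UpperMoment.deviation f e q α') := by
  obtain ⟨h1, h2⟩ := UpperMoment.dominated_deviationAt hp hα₀ hα' hpq
  -- The two sign conditions exclude each other and involve only the parameters, so k can be chosen
  -- to suit whichever one holds.
  by_cases hlower : 0 < UpperMoment.xi p α₀ q ∧ Even (UpperMoment.numLt α') ∨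
      UpperMoment.xi p α₀ q < 0 ∧ Odd (UpperMoment.numLt α')
  · obtain ⟨k, hk, H⟩ := (h1 hlower).exists_mul_le
    refine ⟨k, hk, fun f e hf => ⟨fun _ => H ⟨⟨f, hf⟩, e⟩, fun hupper => ?_⟩⟩
    rcases hlower with ⟨hξ, hN⟩ | ⟨hξ, hN⟩ <;> rcases hupper with ⟨hξ', hN'⟩ | ⟨hξ', hN'⟩
    · exact absurd hN (Nat.not_even_iff_odd.2 hN')
    · exact absurd hξ hξ'.not_gt
    · exact absurd hξ hξ'.not_gt
    · exact absurd hN' (Nat.not_even_iff_odd.2 hN)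
  · by_cases hupper : 0 < UpperMoment.xi p α₀ q ∧ Odd (UpperMoment.numLt α') ∨
        UpperMoment.xi p α₀ q < 0 ∧ Even (UpperMoment.numLt α')
    · obtain ⟨k, hk, H⟩ := h2 hupper
      exact ⟨k, hk, fun f e hf => ⟨fun h => absurd h hlower, fun _ => H ⟨⟨f, hf⟩, e⟩⟩⟩
    · exact ⟨1, one_pos, fun f e hf => ⟨fun h => absurd h hlower, fun h => absurd h hupper⟩⟩
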